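/- A real random variable $Z$ is called sub-Gaussian with relative moment $\rho>0$ if $\mathbb{E}[\exp(tZ)]\le\exp(t^2\rho^2\,\mathbb{E}[Z^2]/2)$ for all $t\in\mathbb{R}$. A probability distribution $D_X$ over $\mathbb{R}^d$ is called a sub-Gaussian product distribution with relative moment $\rho$ if there is an orthonormal basis $a_1,\dots,a_d$ of $\mathbb{R}^d$ such that, for $X\sim D_X$, the random variables $\langle a_1,X\rangle,\dots,\langle a_d,X\rangle$ are independent and each is sub-Gaussian with relative moment $\rho$. For every $\rho>0$ and every $\delta\in(0,1)$ there are $\beta>0$ and $C>0$, depending only on $\rho$ and $\delta$, such that the following holds. Let $d$ be any dimension, let $D_X$ be any sub-Gaussian product distribution over $\mathbb{R}^d$ with relative moment $\rho$ whose covariance matrix $\Sigma$ satisfies $\Sigma\preceq I$ (that is, $I-\Sigma$ is positive semidefinite), and let $m$ be any non-negative integer with $m\le\beta\cdot\mathrm{tr}(\Sigma)-C$. Let $\mathbf{X}$ be the $m\times d$ matrix whose rows are $m$ independent samples drawn from $D_X$, and let $\lambda_{\min}(\mathbf{X}\mathbf{X}^T)$ be the smallest eigenvalue of its Gram matrix (taken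 to be $0$ if $m=0$). Then \[ \mathbb{P}\bigl[\lambda_{\min}(\mathbf{X}\mathbf{X}^T)\ge m\bigr]\ge\delta . \] -/

import Mathlib

open MeasureTheory ProbabilityTheory

noncomputable section

/-- The real random variable `X` is sub-Gaussian with moment `B ≥ 0`:
`E[exp (t X)]` is finite and at most `exp (t² B² / 2)` for every real `t`. -/
def IsSubGaussian {Ω : Type*} [MeasurableSpace Ω] (X : Ω → ℝ) (B : ℝ) (μ : Measure Ω) : Prop :=
  0 ≤ B ∧ HasSubgaussianMGF X (B ^ 2).toNNReal μ

/-- `X` is sub-Gaussian with relative moment `ρ`: it is sub-Gaussian with moment `ρ √E[X²]`. -/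
def IsRelSubGaussian {Ω : Type*} [MeasurableSpace Ω] (X : Ω → ℝ) (ρ : ℝ) (μ : Measure Ω) : Prop :=
  IsSubGaussian X (ρ * √(∫ ω, X ω ^ 2 ∂μ)) μ

/-- `μ` is a sub-Gaussian product distribution over `ℝ^d` with relative moment `ρ`: in some
orthonormal basis the coordinates of `X ∼ μ` are independent and sub-Gaussian with relative
moment `ρ`. -/
def IsSubGaussianProduct {d : ℕ} (ρ : ℝ) (μ : Measure (EuclideanSpace ℝ (Fin d))) : Prop :=
  ∃ a : OrthonormalBasis (Fin d) ℝ (EuclideanSpace ℝ (Fin d)),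
    iIndepFun (fun i x => inner ℝ (a i) x) μ ∧
      ∀ i, IsRelSubGaussian (fun x => inner ℝ (a i) x) ρ μ

/-- The covariance matrix of a distribution over `ℝ^d`. -/
def covMatrix {d : ℕ} (μ : Measure (EuclideanSpace ℝ (Fin d))) : Matrix (Fin d) (Fin d) ℝ :=
  Matrix.of fun i j => cov[fun x => x i, fun x => x j; μ]

/-- The `m × d` matrix whose rows are the `m` sample points. -/
def sampleMatrix {m d : ℕ} (x : Fin m → EuclideanSpace ℝ (Fin d)) : Matrix (Fin m) (Fin d) ℝ :=
  Matrix.of fun i j => x i j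

/-- The smallest real eigenvalue of a square matrix, used for symmetric matrices. A matrix of
size `0` gets the value `0`. -/
def lambdaMin {m : ℕ} (A : Matrix (Fin m) (Fin m) ℝ) : ℝ :=
  sInf {r : ℝ | Module.End.HasEigenvalue (Matrix.toLin' A) r}

end

/-! ### Moments and Laplace transforms of the square of a sub-Gaussian variable. -/

section SubGaussian

variable {Ω : Type*} [MeasurableSpace Ω] {μ : Measure Ω} [IsProbabilityMeasure μ]
  {X : Ω → ℝ} {c : NNReal}

/-! The smallest eigenvalue of the Gram matrix is the minimum of `‖∑ i, v i • x i‖ ^ 2` over unit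
`v`. For one fixed `v`, the coordinates of this vector in the basis `a` are again independent and
sub-Gaussian with unchanged parameters and second moments `q j`, because the `v i ^ 2` sum to `1`.
The squared norm is thus a sum of independent terms with mean `L = tr Σ`. Chernoff bounds
(`measureReal_sum_sq_ge_le`, `measureReal_sum_sq_le_le`) keep it between `L / 4` and `4 ρ² L` except
with probability exponentially small in `L`; `Σ ⪯ I` enters as `q j ≤ 1`.

A net of the sphere has at most `κ ^ m` points with `κ` depending only on `ρ`, so when `m` is a
small multiple of `L` a union bound covers the whole net. `le_norm_apply_of_net` passes to all unit
vectors: the upper bounds control the operator norm, hence the loss in the lower bound. This gives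
`λ_min ≥ L / 16 ≥ m`. -/

lemma ProbabilityTheory.HasSubgaussianMGF.integral_eq_zero (h : HasSubgaussianMGF X c μ) :
    ∫ ω, X ω ∂μ = 0 := by
  have h0 : (0 : ℝ) ∈ interior (integrableExpSet X μ) := by
    simp [h.integrableExpSet_eq_univ]
  have hmgf : DifferentiableAt ℝ (mgf X μ) 0 := (analyticAt_mgf h0).differentiableAt
  have hexp : HasDerivAt (fun t : ℝ => Real.exp (c * t ^ 2 / 2)) 0 0 := by
    have := (((hasDerivAt_id (0 : ℝ)).pow 2).const_mul (c : ℝ)).div_const 2 |>.exp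
    simpa using this
  -- The two functions agree at `0` and one dominates the other everywhere, so their derivatives at
  -- `0` agree.
  have hmin : IsLocalMin (fun t => Real.exp (c * t ^ 2 / 2) - mgf X μ t) 0 :=
    Filter.Eventually.of_forall fun t => by
      have := h.mgf_le t
      simp
      linarith
  have hd := hmin.hasDerivAt_eq_zero (hexp.sub hmgf.hasDerivAt)
  rw [deriv_mgf_zero h0] at hd
  linarith

/-- The Gaussian integral `E exp(a g²)` of a standard Gaussian `g`, as a Lebesgue integral. -/
lemma lintegral_exp_mul_sq_gaussianReal {a : ℝ} (ha : a < 1 / 2) :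
    ∫⁻ g, ENNReal.ofReal (Real.exp (a * g ^ 2)) ∂(gaussianReal 0 1)
      = ENNReal.ofReal ((√(1 - 2 * a))⁻¹) := by
  rw [gaussianReal_of_var_ne_zero _ one_ne_zero,
    lintegral_withDensity_eq_lintegral_mul _ (measurable_gaussianPDF 0 1) (by fun_prop)]
  have hpt : ∀ g : ℝ, (gaussianPDF 0 1 * fun g => ENNReal.ofReal (Real.exp (a * g ^ 2))) g
      = ENNReal.ofReal ((√(2 * Real.pi))⁻¹ * Real.exp (-(1 / 2 - a) * g ^ 2)) := by
    intro g
    simp only [Pi.mul_apply, gaussianPDF, gaussianPDFReal]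
    rw [← ENNReal.ofReal_mul (by positivity), mul_assoc, ← Real.exp_add]
    congr 3
    · simp
    · simp; ring
  simp_rw [hpt]
  rw [← ofReal_integral_eq_lintegral_ofReal]
  · rw [integral_const_mul, integral_gaussian]
    congr 1
    rw [← Real.sqrt_inv, ← Real.sqrt_inv, ← Real.sqrt_mul (by positivity)]
    congr 1
    have : (1 / 2 - a) ≠ 0 := by linarith
    have h2 : (1 - 2 * a) ≠ 0 := by linarith
    have := Real.pi_ne_zero
    field_simp
  · exact (integrable_exp_neg_mul_sq (by linarith)).const_mul _
  · exact Filter.Eventually.of_forall fun g => by positivity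

lemma inv_sqrt_one_sub_two_mul_le_exp {x : ℝ} (hx : 0 ≤ x) (hx' : x ≤ 1 / 4) :
    (√(1 - 2 * x))⁻¹ ≤ Real.exp (2 * x) := by
  have hpos : 0 < 1 - 2 * x := by linarith
  rw [inv_le_comm₀ (Real.sqrt_pos.2 hpos) (Real.exp_pos _), ← Real.exp_neg]
  apply Real.le_sqrt_of_sq_le
  rw [← Real.exp_nat_mul]
  have h1 : 1 + 4 * x ≤ Real.exp (4 * x) := by linarith [Real.add_one_le_exp (4 * x)]
  have h2 : Real.exp ((2 : ℕ) * -(2 * x)) * Real.exp (4 * x) = 1 := by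
    rw [← Real.exp_add]; norm_num; ring
  have h3 := Real.exp_pos ((2 : ℕ) * -(2 * x))
  set e := Real.exp ((2 : ℕ) * -(2 * x))
  have h4 : e * (1 + 4 * x) ≤ 1 := by nlinarith
  have h5 : 1 ≤ (1 - 2 * x) * (1 + 4 * x) := by nlinarith
  nlinarith

/-- Gaussian linearization: `exp (s x²)` is the mean of `exp (√(2s) x g)` over a standard Gaussian
`g`. After Tonelli, the sub-Gaussian bound applies for each fixed `g` and a Gaussian integral
remains. -/
lemma ProbabilityTheory.HasSubgaussianMGF.lintegral_exp_mul_sq_le (h : HasSubgaussianMGF X c μ)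
    (hX : Measurable X) {s : ℝ} (hs : 0 ≤ s) (hsc : 4 * (s * c) ≤ 1) :
    ∫⁻ ω, ENNReal.ofReal (Real.exp (s * X ω ^ 2)) ∂μ ≤ ENNReal.ofReal (Real.exp (2 * (s * c))) := by
  have hint (t : ℝ) : ENNReal.ofReal (Real.exp (s * t ^ 2))
      = ∫⁻ g, ENNReal.ofReal (Real.exp (√(2 * s) * t * g)) ∂(gaussianReal 0 1) := by
    rw [← ofReal_integral_eq_lintegral_ofReal (integrable_exp_mul_gaussianReal _)
      (Filter.Eventually.of_forall fun g => by positivity)]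
    have := congrFun (mgf_fun_id_gaussianReal (μ := 0) (v := 1)) (√(2 * s) * t)
    rw [mgf] at this
    rw [this, mul_pow, Real.sq_sqrt (by positivity)]
    congr 2
    simp
    ring
  have hsc' : s * c < 1 / 2 := by linarith
  calc ∫⁻ ω, ENNReal.ofReal (Real.exp (s * X ω ^ 2)) ∂μ
      = ∫⁻ ω, ∫⁻ g, ENNReal.ofReal (Real.exp (√(2 * s) * X ω * g)) ∂(gaussianReal 0 1) ∂μ := by
        simp_rw [hint]
    _ = ∫⁻ g, ∫⁻ ω, ENNReal.ofReal (Real.exp (√(2 * s) * X ω * g)) ∂μ ∂(gaussianReal 0 1) :=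
        lintegral_lintegral_swap (by fun_prop)
    _ ≤ ∫⁻ g, ENNReal.ofReal (Real.exp (s * c * g ^ 2)) ∂(gaussianReal 0 1) := by
        refine lintegral_mono fun g => ?_
        have hcomm : ∀ ω, √(2 * s) * X ω * g = (√(2 * s) * g) * X ω := fun ω => by ring
        simp_rw [hcomm]
        rw [← ofReal_integral_eq_lintegral_ofReal (h.integrable_exp_mul _)
          (Filter.Eventually.of_forall fun g => by positivity)]
        apply ENNReal.ofReal_le_ofReal
        refine (h.mgf_le (√(2 * s) * g)).trans_eq ?_
        rw [mul_pow, Real.sq_sqrt (by positivity)]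
        congr 1
        ring
    _ = ENNReal.ofReal ((√(1 - 2 * (s * c)))⁻¹) := lintegral_exp_mul_sq_gaussianReal hsc'
    _ ≤ _ := ENNReal.ofReal_le_ofReal
        (inv_sqrt_one_sub_two_mul_le_exp (by positivity) (by linarith))

lemma ProbabilityTheory.HasSubgaussianMGF.integrable_exp_mul_sq (h : HasSubgaussianMGF X c μ)
    (hX : Measurable X) {s : ℝ} (hs : 0 ≤ s) (hsc : 4 * (s * c) ≤ 1) :
    Integrable (fun ω => Real.exp (s * X ω ^ 2)) μ := by
  refine (lintegral_ofReal_ne_top_iff_integrable (by fun_prop)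
    (Filter.Eventually.of_forall fun g => by positivity)).1 ?_
  exact ((h.lintegral_exp_mul_sq_le hX hs hsc).trans_lt ENNReal.ofReal_lt_top).ne

lemma ProbabilityTheory.HasSubgaussianMGF.mgf_sq_le (h : HasSubgaussianMGF X c μ)
    (hX : Measurable X) {s : ℝ} (hs : 0 ≤ s) (hsc : 4 * (s * c) ≤ 1) :
    mgf (fun ω => X ω ^ 2) μ s ≤ Real.exp (2 * (s * c)) := by
  have := h.lintegral_exp_mul_sq_le hX hs hsc
  rw [← ofReal_integral_eq_lintegral_ofReal (h.integrable_exp_mul_sq hX hs hsc)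
    (Filter.Eventually.of_forall fun g => by positivity)] at this
  exact (ENNReal.ofReal_le_ofReal_iff (by positivity)).1 this

lemma ProbabilityTheory.HasSubgaussianMGF.integral_pow_four_le (h : HasSubgaussianMGF X c μ)
    (hX : Measurable X) : ∫ ω, X ω ^ 4 ∂μ ≤ 64 * (c : ℝ) ^ 2 := by
  rcases eq_or_ne c 0 with rfl | hc
  · have h0 := h.ae_eq_zero_of_hasSubgaussianMGF_zero
    rw [integral_congr_ae (g := fun _ => (0 : ℝ))]
    · simp
    · filter_upwards [h0] with ω hω
      simp [hω]
  have hc' : (0 : ℝ) < c := by positivity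
  set s : ℝ := 1 / (4 * c) with hs
  have hspos : 0 < s := by positivity
  have hsc : s * c = 1 / 4 := by rw [hs]; field_simp
  have hint := h.integrable_exp_mul_sq hX hspos.le (by rw [hsc]; norm_num)
  have hle := h.mgf_sq_le hX hspos.le (by rw [hsc]; norm_num)
  rw [hsc, mgf] at hle
  have hexp : Real.exp (2 * (1 / 4)) ≤ 2 := by
    have := Real.exp_one_lt_d9
    have h2 : Real.exp (2 * (1 / 4)) ^ 2 = Real.exp 1 := by
      rw [← Real.exp_nat_mul]; norm_num
    nlinarith [Real.exp_pos (2 * (1 / 4))]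
  -- This is `y² / 2 ≤ exp y` at `y = s X²`.
  have hpt : ∀ ω, X ω ^ 4 ≤ 2 / s ^ 2 * Real.exp (s * X ω ^ 2) := by
    intro ω
    have := Real.quadratic_le_exp_of_nonneg (x := s * X ω ^ 2) (by positivity)
    rw [div_mul_eq_mul_div, le_div_iff₀ (by positivity)]
    have h3 : 0 ≤ s * X ω ^ 2 := by positivity
    nlinarith
  calc ∫ ω, X ω ^ 4 ∂μ ≤ ∫ ω, 2 / s ^ 2 * Real.exp (s * X ω ^ 2) ∂μ :=
        integral_mono_of_nonneg (Filter.Eventually.of_forall fun g => by positivity)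
          (hint.const_mul _) (Filter.Eventually.of_forall hpt)
    _ = 2 / s ^ 2 * ∫ ω, Real.exp (s * X ω ^ 2) ∂μ := integral_const_mul _ _
    _ ≤ 2 / s ^ 2 * 2 := by gcongr; exact hle.trans hexp
    _ = 64 * (c : ℝ) ^ 2 := by rw [hs]; field_simp; norm_num

lemma exp_neg_le_quadratic {y : ℝ} (hy : 0 ≤ y) : Real.exp (-y) ≤ 1 - y + y ^ 2 / 2 := by
  have h := Real.quadratic_le_exp_of_nonneg hy
  rw [Real.exp_neg, inv_le_comm₀ (Real.exp_pos _) (by nlinarith [sq_nonneg (y - 1)])]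
  refine le_trans ?_ h
  rw [inv_le_iff_one_le_mul₀ (by nlinarith [sq_nonneg (y - 1)])]
  -- The product `(1 - y + y²/2)(1 + y + y²/2)` equals `1 + y⁴/4`.
  nlinarith [sq_nonneg (y ^ 2)]

/-- As `X²` is nonnegative, the second-order bound on `exp (-y)` holds pointwise, so a fourth moment
suffices and `t` needs no upper limit. -/
lemma ProbabilityTheory.HasSubgaussianMGF.mgf_sq_neg_le (h : HasSubgaussianMGF X c μ)
    (hX : Measurable X) {t : ℝ} (ht : 0 ≤ t) :
    mgf (fun ω => X ω ^ 2) μ (-t)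
      ≤ Real.exp (-(t * ∫ ω, X ω ^ 2 ∂μ) + 32 * t ^ 2 * (c : ℝ) ^ 2) := by
  have h2 : Integrable (fun ω => X ω ^ 2) μ := (h.memLp 2).integrable_sq
  have h4 : Integrable (fun ω => X ω ^ 4) μ := by
    have := (h.memLp 4).integrable_norm_pow (by norm_num)
    simpa [Even.pow_abs (show Even 4 by decide)] using this
  have h1 : Integrable (fun ω => 1 - t * X ω ^ 2) μ := (integrable_const _).sub (h2.const_mul _)
  have hpt : ∀ ω, Real.exp (-t * X ω ^ 2) ≤ 1 - t * X ω ^ 2 + t ^ 2 / 2 * X ω ^ 4 := by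
    intro ω
    have := exp_neg_le_quadratic (y := t * X ω ^ 2) (by positivity)
    rw [neg_mul]
    linarith
  calc mgf (fun ω => X ω ^ 2) μ (-t)
      ≤ ∫ ω, (1 - t * X ω ^ 2 + t ^ 2 / 2 * X ω ^ 4) ∂μ :=
        integral_mono_of_nonneg (Filter.Eventually.of_forall fun g => by positivity)
          (h1.add (h4.const_mul _))
          (Filter.Eventually.of_forall hpt)
    _ = 1 - t * ∫ ω, X ω ^ 2 ∂μ + t ^ 2 / 2 * ∫ ω, X ω ^ 4 ∂μ := by
        rw [integral_add h1 (h4.const_mul _),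
          integral_sub (integrable_const _) (h2.const_mul _), integral_const_mul,
          integral_const_mul]
        simp
    _ ≤ 1 - t * ∫ ω, X ω ^ 2 ∂μ + t ^ 2 / 2 * (64 * (c : ℝ) ^ 2) := by
        gcongr
        exact h.integral_pow_four_le hX
    _ ≤ _ := by
        refine le_trans (le_of_eq ?_) (Real.add_one_le_exp _)
        ring

end SubGaussian

/-! ### Nets of the unit sphere. -/

section Net

variable {E : Type*} [NormedAddCommGroup E] [NormedSpace ℝ E]

open scoped Function in
/-- The volume bound for an `ε`-separated subset of the unit ball. -/
lemma card_le_of_separated_unitBall [FiniteDimensional ℝ E] {ε : ℝ} (hε : 0 < ε)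
    (s : Finset E) (hs : ∀ c ∈ s, ‖c‖ ≤ 1)
    (h : ∀ c ∈ s, ∀ d ∈ s, c ≠ d → ε ≤ ‖c - d‖) :
    (s.card : ℝ) ≤ (1 + 2 / ε) ^ Module.finrank ℝ E := by
  borelize E
  let μ : Measure E := Measure.addHaar
  have hδ : 0 < ε / 2 := by positivity
  have hR : 0 < 1 + ε / 2 := by positivity
  have hdisj : Set.Pairwise (s : Set E) (Disjoint on fun c => Metric.ball (c : E) (ε / 2)) := by
    rintro c hc d hd hcd
    apply Metric.ball_disjoint_ball
    rw [dist_eq_norm]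
    linarith [h c hc d hd hcd]
  have hsub : (⋃ c ∈ s, Metric.ball (c : E) (ε / 2)) ⊆ Metric.ball (0 : E) (1 + ε / 2) := by
    refine Set.iUnion₂_subset fun x hx => Metric.ball_subset_ball' ?_
    rw [dist_zero_right]
    linarith [hs x hx]
  have hvol := measure_mono (μ := μ) hsub
  rw [measure_biUnion_finset hdisj fun c _ => measurableSet_ball] at hvol
  simp only [μ.addHaar_ball_of_pos _ hδ, μ.addHaar_ball_of_pos _ hR, Finset.sum_const,
    nsmul_eq_mul, ← mul_assoc] at hvol
  have hcard := (ENNReal.mul_le_mul_iff_left (Metric.measure_ball_pos μ _ zero_lt_one).ne'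
    measure_ball_lt_top.ne).1 hvol
  have hreal := ENNReal.toReal_le_of_le_ofReal (pow_nonneg hR.le _) hcard
  rw [ENNReal.toReal_mul, ENNReal.toReal_natCast, ENNReal.toReal_ofReal (by positivity),
    ← le_div_iff₀ (by positivity), ← div_pow] at hreal
  have heq : 1 + 2 / ε = (1 + ε / 2) / (ε / 2) := by
    field_simp
    ring
  rwa [heq]

/-- The unit sphere has an `ε`-net of size exponential in the dimension. -/
lemma exists_finset_net_sphere [FiniteDimensional ℝ E] {ε : ℝ} (hε : 0 < ε) :
    ∃ N : Finset E, (∀ v ∈ N, ‖v‖ = 1) ∧ (∀ u : E, ‖u‖ = 1 → ∃ v ∈ N, ‖u - v‖ ≤ ε) ∧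
      (N.card : ℝ) ≤ (1 + 2 / ε) ^ Module.finrank ℝ E := by
  classical
  -- A separated set of maximal cardinality is a net; the volume bound makes the maximum exist.
  let P : ℕ → Prop := fun k => ∃ N : Finset E, (∀ v ∈ N, ‖v‖ = 1) ∧
    (∀ c ∈ N, ∀ d ∈ N, c ≠ d → ε ≤ ‖c - d‖) ∧ N.card = k
  have hbound : ∀ k, P k → k ≤ ⌊(1 + 2 / ε) ^ Module.finrank ℝ E⌋₊ := by
    rintro k ⟨N, h1, h2, rfl⟩
    exact Nat.le_floor (card_le_of_separated_unitBall hε N (fun c hc => (h1 c hc).le) h2)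
  have hP0 : P 0 := ⟨∅, by simp⟩
  obtain ⟨N, h1, h2, h3⟩ := Nat.findGreatest_spec (P := P) (Nat.zero_le _) hP0
  refine ⟨N, h1, fun u hu => ?_, card_le_of_separated_unitBall hε N (fun c hc => (h1 c hc).le) h2⟩
  by_contra! hfar
  have hu_notMem : u ∉ N := fun huN => by
    have := hfar u huN
    simp at this
    linarith
  have hP : P (N.card + 1) := by
    refine ⟨insert u N, ?_, ?_, Finset.card_insert_of_notMem hu_notMem⟩
    · intro v hv
      rcases Finset.mem_insert.1 hv with rfl | hv
      exacts [hu, h1 v hv]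
    · intro c hc d hd hcd
      rcases Finset.mem_insert.1 hc with rfl | hc' <;> rcases Finset.mem_insert.1 hd with rfl | hd'
      · exact absurd rfl hcd
      · exact (hfar d hd').le
      · rw [norm_sub_rev]; exact (hfar c hc').le
      · exact h2 c hc' d hd' hcd
  have := Nat.le_findGreatest (hbound _ hP) hP
  rw [← h3] at this
  omega

variable {F : Type*} [NormedAddCommGroup F] [NormedSpace ℝ F]

/-- Two-sided control of a linear map on a net of the sphere gives a lower bound on the sphere. -/
lemma le_norm_apply_of_net (T : E →L[ℝ] F) {N : Finset E} {ε a b : ℝ} (hε0 : 0 ≤ ε)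
    (hε : ε ≤ 1 / 2) (hb : 0 ≤ b) (hN : ∀ u : E, ‖u‖ = 1 → ∃ v ∈ N, ‖u - v‖ ≤ ε)
    (hlow : ∀ v ∈ N, a ≤ ‖T v‖) (hup : ∀ v ∈ N, ‖T v‖ ≤ b) (u : E) (hu : ‖u‖ = 1) :
    a - 2 * ε * b ≤ ‖T u‖ := by
  -- Self-bounding estimate: the error off the net is itself measured by `‖T‖`, and is absorbed
  -- since `ε ≤ 1 / 2`.
  have hT : ‖T‖ ≤ b + ε * ‖T‖ := by
    refine T.opNorm_le_of_unit_norm (by positivity) fun w hw => ?_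
    obtain ⟨v, hv, hwv⟩ := hN w hw
    calc ‖T w‖ = ‖T v + T (w - v)‖ := by rw [← map_add]; simp
      _ ≤ ‖T v‖ + ‖T (w - v)‖ := norm_add_le _ _
      _ ≤ b + ‖T‖ * ‖w - v‖ := add_le_add (hup v hv) (T.le_opNorm _)
      _ ≤ b + ‖T‖ * ε := by gcongr
      _ = b + ε * ‖T‖ := by ring
  have hT2 : ‖T‖ ≤ 2 * b := by nlinarith [norm_nonneg T]
  obtain ⟨v, hv, huv⟩ := hN u hu
  have h1 : ‖T v‖ ≤ ‖T u‖ + ‖T (u - v)‖ := by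
    calc ‖T v‖ = ‖T u - T (u - v)‖ := by rw [← map_sub]; simp
      _ ≤ _ := norm_sub_le _ _
  have h2 : ‖T (u - v)‖ ≤ 2 * b * ε :=
    (T.le_opNorm _).trans (mul_le_mul hT2 huv (norm_nonneg _) (by positivity))
  linarith [hlow v hv]

end Net

/-! ### Smallest eigenvalue of the Gram matrix. -/

section Gram

variable {m d : ℕ}

/-- The linear map `v ↦ ∑ i, v i • x i` given by the transpose of the sample matrix. -/
noncomputable def sampleCombination (x : Fin m → EuclideanSpace ℝ (Fin d)) :
    EuclideanSpace ℝ (Fin m) →L[ℝ] EuclideanSpace ℝ (Fin d) :=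
  LinearMap.toContinuousLinearMap
    (∑ i, (EuclideanSpace.proj i : EuclideanSpace ℝ (Fin m) →L[ℝ] ℝ).toLinearMap.smulRight (x i))

lemma sampleCombination_apply (x : Fin m → EuclideanSpace ℝ (Fin d))
    (v : EuclideanSpace ℝ (Fin m)) : sampleCombination x v = ∑ i, v i • x i := by
  simp [sampleCombination]

lemma norm_sq_sampleCombination (x : Fin m → EuclideanSpace ℝ (Fin d)) (v : Fin m → ℝ) :
    ‖sampleCombination x (WithLp.toLp 2 v)‖ ^ 2
      = v ⬝ᵥ (Matrix.mulVec (sampleMatrix x * (sampleMatrix x).transpose) v) := by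
  rw [← Matrix.mulVec_mulVec, Matrix.dotProduct_mulVec, ← Matrix.mulVec_transpose,
    EuclideanSpace.norm_sq_eq, sampleCombination_apply]
  simp only [dotProduct, Matrix.mulVec, sampleMatrix, Real.norm_eq_abs, sq_abs]
  refine Finset.sum_congr rfl fun j _ => ?_
  simp [sq, mul_comm]

lemma le_lambdaMin_gram (hm : 0 < m) (x : Fin m → EuclideanSpace ℝ (Fin d)) {r : ℝ} (hr : 0 ≤ r)
    (h : ∀ u : EuclideanSpace ℝ (Fin m), ‖u‖ = 1 → r ≤ ‖sampleCombination x u‖) :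
    r ^ 2 ≤ lambdaMin (sampleMatrix x * (sampleMatrix x).transpose) := by
  set A := sampleMatrix x * (sampleMatrix x).transpose with hA
  have hH : A.IsHermitian := by
    simpa using Matrix.isHermitian_mul_conjTranspose_self (sampleMatrix x)
  apply le_csInf
  -- The eigenvalue set must be nonempty, as `sInf ∅ = 0`; this is where `0 < m` is used.
  · refine ⟨hH.eigenvalues ⟨0, hm⟩, ?_⟩
    rw [Set.mem_ofPred_eq, Module.End.hasEigenvalue_iff_mem_spectrum, Matrix.spectrum_toLin']
    exact hH.eigenvalues_mem_spectrum_real _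
  · rintro e he
    obtain ⟨w, hw⟩ := he.exists_hasEigenvector
    have hAw : A.mulVec w = e • w := by simpa using hw.apply_eq_smul
    have hw0 : (WithLp.toLp 2 w : EuclideanSpace ℝ (Fin m)) ≠ 0 := by
      simpa using hw.2
    set z : EuclideanSpace ℝ (Fin m) := WithLp.toLp 2 w
    have hz : 0 < ‖z‖ := norm_pos_iff.2 hw0
    have hTz : ‖sampleCombination x z‖ ^ 2 = e * ‖z‖ ^ 2 := by
      rw [norm_sq_sampleCombination, ← hA, hAw, dotProduct_smul, EuclideanSpace.norm_sq_eq]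
      simp [dotProduct, z, sq]
    have hrz : r * ‖z‖ ≤ ‖sampleCombination x z‖ := by
      have := h ((‖z‖⁻¹ : ℝ) • z) (by simp [norm_smul, hz.ne'])
      rw [map_smul, norm_smul, norm_inv, norm_norm, inv_mul_eq_div, le_div_iff₀ hz] at this
      exact this
    have : r ^ 2 * ‖z‖ ^ 2 ≤ e * ‖z‖ ^ 2 := by
      rw [← hTz, ← mul_pow]
      gcongr
    exact le_of_mul_le_mul_right this (by positivity)

end Gram

/-! ### Covariance matrix and second moments in an orthonormal basis. -/

section Covariance

variable {d : ℕ} {μ : Measure (EuclideanSpace ℝ (Fin d))}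

lemma coord_eq_sum_basis (a : OrthonormalBasis (Fin d) ℝ (EuclideanSpace ℝ (Fin d))) (i : Fin d) :
    (fun x : EuclideanSpace ℝ (Fin d) => x i) = fun x => ∑ j, a j i * inner ℝ (a j) x := by
  ext x
  conv_lhs => rw [← a.sum_repr' x]
  simp [mul_comm]

lemma memLp_coord_of_basis (a : OrthonormalBasis (Fin d) ℝ (EuclideanSpace ℝ (Fin d)))
    (h : ∀ j, MemLp (fun x => inner ℝ (a j) x) 2 μ) (i : Fin d) : MemLp (fun x => x i) 2 μ := by
  rw [coord_eq_sum_basis a i]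
  exact memLp_finsetSum _ fun j _ => (h j).const_mul _

variable [IsProbabilityMeasure μ]

lemma dotProduct_covMatrix_mulVec (h : ∀ i, MemLp (fun x => x i) 2 μ)
    (b : EuclideanSpace ℝ (Fin d)) :
    (b : Fin d → ℝ) ⬝ᵥ (covMatrix μ).mulVec (b : Fin d → ℝ)
      = Var[fun x => inner ℝ b x; μ] := by
  have hb : (fun x : EuclideanSpace ℝ (Fin d) => inner ℝ b x) = fun x => ∑ i, b i * x i := by
    ext x
    simp [PiLp.inner_apply, mul_comm]
  rw [hb, ← covariance_self (Measurable.aemeasurable (by fun_prop)),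
    covariance_fun_sum_fun_sum (fun i => (h i).const_mul _) (fun i => (h i).const_mul _)]
  simp only [dotProduct, Matrix.mulVec, covMatrix, Matrix.of_apply, Finset.mul_sum,
    covariance_const_mul_left, covariance_const_mul_right]
  exact Finset.sum_congr rfl fun i _ => Finset.sum_congr rfl fun j _ => by ring

lemma trace_covMatrix_eq (a : OrthonormalBasis (Fin d) ℝ (EuclideanSpace ℝ (Fin d)))
    (h : ∀ j, MemLp (fun x => inner ℝ (a j) x) 2 μ)
    (h0 : ∀ j, ∫ x, inner ℝ (a j) x ∂μ = 0) :
    (covMatrix μ).trace = ∑ j, ∫ x, inner ℝ (a j) x ^ 2 ∂μ := by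
  have hc := memLp_coord_of_basis a h
  have hmean : ∀ i, ∫ x, x i ∂μ = 0 := by
    intro i
    rw [coord_eq_sum_basis a i, integral_finsetSum _ fun j _ => ((h j).integrable one_le_two).const_mul _]
    simp [integral_const_mul, h0]
  have hdiag : ∀ i, covMatrix μ i i = ∫ x, x i ^ 2 ∂μ := by
    intro i
    rw [covMatrix, Matrix.of_apply, covariance_self (Measurable.aemeasurable (by fun_prop)),
      variance_of_integral_eq_zero (Measurable.aemeasurable (by fun_prop)) (hmean i)]
  simp only [Matrix.trace, Matrix.diag, hdiag]
  rw [← integral_finsetSum _ fun i _ => (hc i).integrable_sq,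
    ← integral_finsetSum _ fun i _ => (h i).integrable_sq]
  refine integral_congr_ae (Filter.Eventually.of_forall fun x => ?_)
  have h1 := a.sum_sq_norm_inner_right x
  rw [EuclideanSpace.norm_sq_eq] at h1
  simpa using h1.symm

lemma integral_inner_sq_le_one (h : ∀ i, MemLp (fun x => x i) 2 μ)
    (hcov : (1 - covMatrix μ).PosSemidef) (b : EuclideanSpace ℝ (Fin d)) (hb : ‖b‖ = 1)
    (h0 : ∫ x, inner ℝ b x ∂μ = 0) : ∫ x, inner ℝ b x ^ 2 ∂μ ≤ 1 := by
  have hquad := hcov.dotProduct_mulVec_nonneg (b : Fin d → ℝ)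
  have hbb : (b : Fin d → ℝ) ⬝ᵥ (b : Fin d → ℝ) = 1 := by
    have := EuclideanSpace.norm_sq_eq b
    rw [hb] at this
    simpa [dotProduct, sq] using this.symm
  simp only [star_trivial] at hquad
  rw [Matrix.sub_mulVec, Matrix.one_mulVec, dotProduct_sub, hbb, dotProduct_covMatrix_mulVec h,
    variance_of_integral_eq_zero (Measurable.aemeasurable (by fun_prop)) h0] at hquad
  linarith

end Covariance

/-! ### Independence of the columns of an independent array. -/

section Independence

/-- If a doubly indexed family is independent then so are its columns. -/
lemma iIndepFun_columns {ι κ Ω : Type*} [MeasurableSpace Ω] {P : Measure Ω}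
    {X : ι → κ → Ω → ℝ} (mX : ∀ i j, Measurable (X i j))
    (h : iIndepFun (fun (p : ι × κ) ω => X p.1 p.2 ω) P) :
    iIndepFun (fun (j : κ) ω (i : ι) => X i j ω) P := by
  have := h.isProbabilityMeasure
  have hprob : ∀ (j : κ) (i : ι), IsProbabilityMeasure (P.map (X i j)) :=
    fun j i => Measure.isProbabilityMeasure_map (mX i j).aemeasurable
  have hsigma : iIndepFun (fun (p : (_ : κ) × ι) ω => X p.2 p.1 ω) P :=
    h.precomp (g := fun p : (_ : κ) × ι => (p.2, p.1)) (by
      rintro ⟨j, i⟩ ⟨j', i'⟩ hp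
      simp only [Prod.mk.injEq] at hp
      rw [hp.1, hp.2])
  have hcol : ∀ j, iIndepFun (fun (i : ι) ω => X i j ω) P := fun j =>
    h.precomp (g := fun i : ι => (i, j)) (fun i i' hp => by simpa using hp)
  have hmap := (iIndepFun_iff_map_fun_eq_infinitePi_map (by fun_prop)).1 hsigma
  -- Currying turns the product law of the array into a product of products, whose inner factors are
  -- the column laws.
  have hcurry := congrArg
    (Measure.map (MeasurableEquiv.piCurry (fun (_ : κ) (_ : ι) => ℝ))) hmap
  rw [Measure.map_map (by fun_prop) (by fun_prop),
    Measure.infinitePi_map_piCurry (fun j i => P.map (X i j))] at hcurry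
  rw [iIndepFun_iff_map_fun_eq_infinitePi_map (by fun_prop)]
  refine hcurry.trans ?_
  congr 1
  ext1 j
  exact ((iIndepFun_iff_map_fun_eq_infinitePi_map (by fun_prop)).1 (hcol j)).symm

end Independence

/-! ### Chernoff bounds for sums of independent squares. -/

section Concentration

variable {Ω ι : Type*} [MeasurableSpace Ω] {μ : Measure Ω} [Fintype ι]
  {S : ι → Ω → ℝ} {c : ι → NNReal} {q : ι → ℝ} {ρ : ℝ}

lemma mgf_sum_sq_eq_prod (hS : ∀ j, Measurable (S j)) (hind : iIndepFun S μ) (s : ℝ) :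
    mgf (fun ω => ∑ j, S j ω ^ 2) μ s = ∏ j, mgf (fun ω => S j ω ^ 2) μ s := by
  have hind2 : iIndepFun (fun j ω => S j ω ^ 2) μ :=
    hind.comp (fun _ y => y ^ 2) fun _ => by fun_prop
  rw [← hind2.mgf_sum (fun j => by fun_prop) Finset.univ]
  congr 1
  ext ω
  simp

variable [IsProbabilityMeasure μ]

lemma integrable_exp_mul_sum_sq (hS : ∀ j, Measurable (S j)) (hind : iIndepFun S μ) {s : ℝ}
    (h : ∀ j, Integrable (fun ω => Real.exp (s * S j ω ^ 2)) μ) :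
    Integrable (fun ω => Real.exp (s * ∑ j, S j ω ^ 2)) μ := by
  have hind2 : iIndepFun (fun j ω => S j ω ^ 2) μ :=
    hind.comp (fun _ y => y ^ 2) fun _ => by fun_prop
  have := hind2.integrable_exp_mul_sum (t := s) (fun j => by fun_prop) (s := Finset.univ)
    fun j _ => h j
  simpa using this

lemma measureReal_sum_sq_ge_le (hρ : 0 < ρ) (hS : ∀ j, Measurable (S j)) (hind : iIndepFun S μ)
    (hsub : ∀ j, HasSubgaussianMGF (S j) (c j) μ) (hc : ∀ j, (c j : ℝ) = ρ ^ 2 * q j)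
    (hq1 : ∀ j, q j ≤ 1) :
    μ.real {ω | 4 * ρ ^ 2 * ∑ j, q j ≤ ∑ j, S j ω ^ 2} ≤ Real.exp (-(1 / 2) * ∑ j, q j) := by
  -- The largest `s` for which `q j ≤ 1` guarantees `4 * (s * c j) ≤ 1`. The exponent is then `-∑ q
  -- + ∑ q / 2`.
  set s : ℝ := 1 / (4 * ρ ^ 2) with hs
  have hspos : 0 < s := by positivity
  have hsc : ∀ j, s * c j = q j / 4 := fun j => by rw [hc, hs]; field_simp
  have hsc' : ∀ j, 4 * (s * c j) ≤ 1 := fun j => by rw [hsc]; linarith [hq1 j]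
  refine (measure_ge_le_exp_mul_mgf _ hspos.le (integrable_exp_mul_sum_sq hS hind fun j =>
    (hsub j).integrable_exp_mul_sq (hS j) hspos.le (hsc' j))).trans ?_
  have hmgf : mgf (fun ω => ∑ j, S j ω ^ 2) μ s ≤ Real.exp (∑ j, q j / 2) := by
    rw [mgf_sum_sq_eq_prod hS hind, Real.exp_sum]
    refine Finset.prod_le_prod (fun j _ => mgf_nonneg) fun j _ => ?_
    refine ((hsub j).mgf_sq_le (hS j) hspos.le (hsc' j)).trans_eq ?_
    rw [hsc]
    congr 1
    ring
  refine (mul_le_mul_of_nonneg_left hmgf (Real.exp_pos _).le).trans_eq ?_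
  rw [← Real.exp_add, ← Finset.sum_div]
  congr 1
  rw [hs]
  field_simp
  ring

lemma measureReal_sum_sq_le_le (hρ : 0 < ρ) (hS : ∀ j, Measurable (S j)) (hind : iIndepFun S μ)
    (hsub : ∀ j, HasSubgaussianMGF (S j) (c j) μ) (hc : ∀ j, (c j : ℝ) = ρ ^ 2 * q j)
    (hq : ∀ j, ∫ ω, S j ω ^ 2 ∂μ = q j) (hq1 : ∀ j, q j ≤ 1) :
    μ.real {ω | ∑ j, S j ω ^ 2 ≤ (∑ j, q j) / 4}
      ≤ Real.exp (-(1 / (256 * ρ ^ 4)) * ∑ j, q j) := by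
  -- Chosen so that the quadratic term is `t / 2 * q j ^ 2`, at most half of the linear gain `t * q
  -- j`.
  set t : ℝ := 1 / (64 * ρ ^ 4) with ht
  have htpos : 0 < t := by positivity
  have hq0 : ∀ j, 0 ≤ q j := fun j => by rw [← hq]; positivity
  have hint : ∀ j, Integrable (fun ω => Real.exp (-t * S j ω ^ 2)) μ := fun j => by
    refine Integrable.of_bound (by fun_prop) 1 (Filter.Eventually.of_forall fun ω => ?_)
    rw [Real.norm_eq_abs, abs_of_pos (Real.exp_pos _), Real.exp_le_one_iff]
    have : 0 ≤ t * S j ω ^ 2 := by positivity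
    linarith
  refine (measure_le_le_exp_mul_mgf _ (neg_nonpos.2 htpos.le)
    (integrable_exp_mul_sum_sq hS hind hint)).trans ?_
  have hmgf : mgf (fun ω => ∑ j, S j ω ^ 2) μ (-t) ≤ Real.exp (∑ j, -(t / 2) * q j) := by
    rw [mgf_sum_sq_eq_prod hS hind, Real.exp_sum]
    refine Finset.prod_le_prod (fun j _ => mgf_nonneg) fun j _ => ?_
    refine ((hsub j).mgf_sq_neg_le (hS j) htpos.le).trans ?_
    rw [hq, hc, Real.exp_le_exp]
    have h1 : 32 * t ^ 2 * (ρ ^ 2 * q j) ^ 2 = t / 2 * q j ^ 2 := by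
      rw [ht]
      field_simp
      ring
    have h2 : q j ^ 2 ≤ q j := by nlinarith [hq0 j, hq1 j]
    rw [h1]
    nlinarith
  refine (mul_le_mul_of_nonneg_left hmgf (Real.exp_pos _).le).trans_eq ?_
  rw [← Real.exp_add, ← Finset.mul_sum]
  congr 1
  rw [ht]
  field_simp
  ring

end Concentration

/-! ### Law of a fixed unit combination of the samples. -/

section Sample

variable {m d : ℕ} {μ : Measure (EuclideanSpace ℝ (Fin d))} [IsProbabilityMeasure μ]
  {a : OrthonormalBasis (Fin d) ℝ (EuclideanSpace ℝ (Fin d))}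

lemma inner_sampleCombination (x : Fin m → EuclideanSpace ℝ (Fin d))
    (v : EuclideanSpace ℝ (Fin m)) (b : EuclideanSpace ℝ (Fin d)) :
    inner ℝ b (sampleCombination x v) = ∑ i, v i * inner ℝ b (x i) := by
  simp [sampleCombination_apply, inner_sum, inner_smul_right]

lemma measurable_inner_sampleCombination (v : EuclideanSpace ℝ (Fin m))
    (b : EuclideanSpace ℝ (Fin d)) :
    Measurable fun x : Fin m → EuclideanSpace ℝ (Fin d) => inner ℝ b (sampleCombination x v) := by
  simp_rw [inner_sampleCombination]
  fun_prop

lemma iIndepFun_inner_sampleCombination (hind : iIndepFun (fun j x => inner ℝ (a j) x) μ)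
    (v : EuclideanSpace ℝ (Fin m)) :
    iIndepFun (fun j (x : Fin m → EuclideanSpace ℝ (Fin d)) =>
      inner ℝ (a j) (sampleCombination x v)) (Measure.pi fun _ => μ) := by
  -- Entries are independent across samples and, within a sample, across coordinates; grouping by
  -- coordinate then gives the claim.
  have hpair : iIndepFun (fun (p : Fin m × Fin d) (x : Fin m → EuclideanSpace ℝ (Fin d)) =>
      (inner ℝ (a p.2) (x p.1) : ℝ)) (Measure.pi fun _ => μ) := by
    refine iIndepFun_uncurry' (X := fun (i : Fin m) (j : Fin d)
      (x : Fin m → EuclideanSpace ℝ (Fin d)) => (inner ℝ (a j) (x i) : ℝ)) (by fun_prop) ?_ ?_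
    · exact iIndepFun_pi (X := fun (_ : Fin m) (y : EuclideanSpace ℝ (Fin d)) (j : Fin d) =>
        (inner ℝ (a j) y : ℝ)) fun i => Measurable.aemeasurable (by fun_prop)
    · intro i
      rw [iIndepFun_iff_map_fun_eq_pi_map (fun j => Measurable.aemeasurable (by fun_prop))] at hind ⊢
      have hev := (measurePreserving_eval (fun _ : Fin m => μ) i).map_eq
      have hlaw : ∀ {β : Type} [MeasurableSpace β] {f : EuclideanSpace ℝ (Fin d) → β},
          Measurable f → (Measure.pi fun _ : Fin m => μ).map (fun x => f (x i)) = μ.map f := by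
        intro β _ f hf
        conv_rhs => rw [← hev]
        rw [Measure.map_map hf (by fun_prop)]
        rfl
      rw [hlaw (f := fun y j => (inner ℝ (a j) y : ℝ)) (by fun_prop), hind]
      congr 1
      ext1 j
      exact (hlaw (f := fun y => (inner ℝ (a j) y : ℝ)) (by fun_prop)).symm
  have hcol := iIndepFun_columns (X := fun (i : Fin m) (j : Fin d)
      (x : Fin m → EuclideanSpace ℝ (Fin d)) => (inner ℝ (a j) (x i) : ℝ)) (by fun_prop) hpair
  simp_rw [inner_sampleCombination]
  exact hcol.comp (fun _ z => ∑ i, v i * z i) fun _ => by fun_prop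

lemma hasSubgaussianMGF_inner_sampleCombination {b : EuclideanSpace ℝ (Fin d)} {c : NNReal}
    (h : HasSubgaussianMGF (fun x => inner ℝ b x) c μ) (v : EuclideanSpace ℝ (Fin m))
    (hv : ‖v‖ = 1) :
    HasSubgaussianMGF (fun x : Fin m → EuclideanSpace ℝ (Fin d) =>
      inner ℝ b (sampleCombination x v)) c (Measure.pi fun _ => μ) := by
  simp_rw [inner_sampleCombination]
  have hind : iIndepFun (fun (i : Fin m) (x : Fin m → EuclideanSpace ℝ (Fin d)) =>
      v i * inner ℝ b (x i)) (Measure.pi fun _ => μ) :=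
    iIndepFun_pi (X := fun (i : Fin m) (y : EuclideanSpace ℝ (Fin d)) => v i * inner ℝ b y)
      fun i => Measurable.aemeasurable (by fun_prop)
  have hi : ∀ i ∈ (Finset.univ : Finset (Fin m)), HasSubgaussianMGF
      (fun x : Fin m → EuclideanSpace ℝ (Fin d) => v i * inner ℝ b (x i))
      ((v i ^ 2).toNNReal * c) (Measure.pi fun _ => μ) := by
    intro i _
    have hev := (measurePreserving_eval (fun _ : Fin m => μ) i).map_eq
    have hproj := HasSubgaussianMGF.of_map (X := fun y => inner ℝ b y)
      (Y := Function.eval i) (μ := Measure.pi fun _ : Fin m => μ)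
      (Measurable.aemeasurable (by fun_prop)) (hev.symm ▸ h)
    rw [Real.toNNReal_of_nonneg (sq_nonneg _)]
    exact hproj.const_mul (v i)
  have := HasSubgaussianMGF.sum_of_iIndepFun hind hi
  convert this using 1
  rw [← Finset.sum_mul]
  have hsum : ∑ i, (v i ^ 2).toNNReal = 1 := by
    ext
    have h2 := EuclideanSpace.norm_sq_eq v
    rw [hv] at h2
    simpa [Real.coe_toNNReal _ (sq_nonneg _)] using h2.symm
  rw [hsum, one_mul]

lemma integral_inner_sampleCombination_sq {b : EuclideanSpace ℝ (Fin d)}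
    (h : MemLp (fun x => inner ℝ b x) 2 μ) (h0 : ∫ x, inner ℝ b x ∂μ = 0)
    (v : EuclideanSpace ℝ (Fin m)) (hv : ‖v‖ = 1) :
    ∫ x : Fin m → EuclideanSpace ℝ (Fin d), inner ℝ b (sampleCombination x v) ^ 2
      ∂(Measure.pi fun _ => μ) = ∫ x, inner ℝ b x ^ 2 ∂μ := by
  have hmp := fun i : Fin m => measurePreserving_eval (fun _ : Fin m => μ) i
  have hLp : ∀ i : Fin m, MemLp (fun x : Fin m → EuclideanSpace ℝ (Fin d) =>
      v i * inner ℝ b (x i)) 2 (Measure.pi fun _ => μ) := fun i =>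
    (h.comp_measurePreserving (hmp i)).const_mul (v i)
  have hmean : ∀ i : Fin m, ∫ x : Fin m → EuclideanSpace ℝ (Fin d), inner ℝ b (x i)
      ∂(Measure.pi fun _ => μ) = 0 := fun i => by
    rw [integral_comp_eval (μ := fun _ : Fin m => μ) (f := fun y => inner ℝ b y)
      (Measurable.aestronglyMeasurable (by fun_prop)), h0]
  have hvar : ∀ i : Fin m, Var[fun x : Fin m → EuclideanSpace ℝ (Fin d) =>
      v i * inner ℝ b (x i); Measure.pi fun _ => μ] = v i ^ 2 * ∫ x, inner ℝ b x ^ 2 ∂μ := by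
    intro i
    rw [variance_const_mul,
      variance_of_integral_eq_zero (Measurable.aemeasurable (by fun_prop)) (hmean i),
      integral_comp_eval (μ := fun _ : Fin m => μ) (f := fun y => inner ℝ b y ^ 2)
        (Measurable.aestronglyMeasurable (by fun_prop))]
  have hind : iIndepFun (fun (i : Fin m) (x : Fin m → EuclideanSpace ℝ (Fin d)) =>
      v i * inner ℝ b (x i)) (Measure.pi fun _ => μ) :=
    iIndepFun_pi (X := fun (i : Fin m) (y : EuclideanSpace ℝ (Fin d)) => v i * inner ℝ b y)
      fun i => Measurable.aemeasurable (by fun_prop)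
  have hsum := IndepFun.variance_sum (s := Finset.univ) (fun i _ => hLp i)
    (fun i _ j _ hij => hind.indepFun hij)
  have hfun : (∑ i, fun x : Fin m → EuclideanSpace ℝ (Fin d) => v i * inner ℝ b (x i))
      = fun x => inner ℝ b (sampleCombination x v) := by
    ext x
    simp [inner_sampleCombination]
  have hmean' : ∫ x : Fin m → EuclideanSpace ℝ (Fin d), inner ℝ b (sampleCombination x v)
      ∂(Measure.pi fun _ => μ) = 0 := by
    simp_rw [inner_sampleCombination]
    rw [integral_finsetSum _ fun i _ => (hLp i).integrable one_le_two]
    simp [integral_const_mul, hmean]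
  rw [hfun, variance_of_integral_eq_zero
    (measurable_inner_sampleCombination v b).aemeasurable hmean'] at hsum
  rw [hsum]
  simp_rw [hvar]
  rw [← Finset.sum_mul]
  have h2 := EuclideanSpace.norm_sq_eq v
  rw [hv] at h2
  simp only [Real.norm_eq_abs, sq_abs] at h2
  rw [← h2]
  simp

lemma norm_sq_eq_sum_inner_sq (a : OrthonormalBasis (Fin d) ℝ (EuclideanSpace ℝ (Fin d)))
    (y : EuclideanSpace ℝ (Fin d)) : ‖y‖ ^ 2 = ∑ j, inner ℝ (a j) y ^ 2 := by
  simpa using (a.sum_sq_norm_inner_right y).symm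

end Sample

/-! ### Union bound over the net and choice of constants. -/

section Main

variable {m d : ℕ} {μ : Measure (EuclideanSpace ℝ (Fin d))} [IsProbabilityMeasure μ] {ρ : ℝ}

/-- A fixed combination `∑ i, v i • x i` of the samples with `‖v‖ = 1` has squared norm of order
`tr Σ`, up to an exponentially small probability. -/
lemma measureReal_norm_sampleCombination_le (hρ : 0 < ρ)
    {a : OrthonormalBasis (Fin d) ℝ (EuclideanSpace ℝ (Fin d))}
    (hind : iIndepFun (fun j x => inner ℝ (a j) x) μ)
    (hsub : ∀ j, IsRelSubGaussian (fun x => inner ℝ (a j) x) ρ μ)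
    (hcov : (1 - covMatrix μ).PosSemidef) (v : EuclideanSpace ℝ (Fin m)) (hv : ‖v‖ = 1) :
    (Measure.pi fun _ : Fin m => μ).real
        ({x | 4 * ρ ^ 2 * (covMatrix μ).trace ≤ ‖sampleCombination x v‖ ^ 2} ∪
          {x | ‖sampleCombination x v‖ ^ 2 ≤ (covMatrix μ).trace / 4})
      ≤ 2 * Real.exp (-min (1 / 2) (1 / (256 * ρ ^ 4)) * (covMatrix μ).trace) := by
  have hmgf := fun j => (hsub j).2
  have hmean := fun j => (hmgf j).integral_eq_zero
  have hLp : ∀ j, MemLp (fun x => inner ℝ (a j) x) 2 μ := fun j => (hmgf j).memLp 2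
  set q : Fin d → ℝ := fun j => ∫ x, inner ℝ (a j) x ^ 2 ∂μ with hq
  have hq0 : ∀ j, 0 ≤ q j := fun j => integral_nonneg fun x => sq_nonneg _
  have hq1 : ∀ j, q j ≤ 1 := fun j =>
    integral_inner_sq_le_one (memLp_coord_of_basis a hLp) hcov (a j) (a.norm_eq_one j) (hmean j)
  have htrace : (covMatrix μ).trace = ∑ j, q j := trace_covMatrix_eq a hLp hmean
  have hc : ∀ j, ((((ρ * √(q j)) ^ 2).toNNReal : NNReal) : ℝ) = ρ ^ 2 * q j := fun j => by
    rw [Real.coe_toNNReal _ (sq_nonneg _), mul_pow, Real.sq_sqrt (hq0 j)]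
  have hS := fun j => measurable_inner_sampleCombination (m := m) v (a j)
  have hSind := iIndepFun_inner_sampleCombination hind v
  have hSsub := fun j => hasSubgaussianMGF_inner_sampleCombination (hmgf j) v hv
  have hSq := fun j => integral_inner_sampleCombination_sq (hLp j) (hmean j) v hv
  have hup := measureReal_sum_sq_ge_le hρ hS hSind hSsub hc hq1
  have hlow := measureReal_sum_sq_le_le hρ hS hSind hSsub hc hSq hq1
  have hsum0 : 0 ≤ ∑ j, q j := Finset.sum_nonneg fun j _ => hq0 j
  simp_rw [norm_sq_eq_sum_inner_sq a, htrace]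
  refine (measureReal_union_le _ _).trans ?_
  rw [two_mul]
  refine add_le_add (hup.trans ?_) (hlow.trans ?_)
  · gcongr
    exact min_le_left _ _
  · gcongr
    exact min_le_right _ _

lemma lambdaMin_nonneg_of_size_zero (A : Matrix (Fin 0) (Fin 0) ℝ) : 0 ≤ lambdaMin A := by
  refine Real.sInf_nonneg fun r hr => ?_
  obtain ⟨w, hw⟩ := Module.End.HasEigenvalue.exists_hasEigenvector hr
  exact absurd (Subsingleton.elim w 0) hw.2

lemma trace_div_le_lambdaMin_of_net (hm : 0 < m) (hρ : 0 < ρ) {L : ℝ} (hL : 0 ≤ L)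
    {N : Finset (EuclideanSpace ℝ (Fin m))}
    (hN : ∀ u : EuclideanSpace ℝ (Fin m), ‖u‖ = 1 →
      ∃ v ∈ N, ‖u - v‖ ≤ min (1 / 2) (1 / (16 * ρ)))
    (x : Fin m → EuclideanSpace ℝ (Fin d))
    (hup : ∀ v ∈ N, ‖sampleCombination x v‖ ^ 2 ≤ 4 * ρ ^ 2 * L)
    (hlow : ∀ v ∈ N, L / 4 ≤ ‖sampleCombination x v‖ ^ 2) :
    L / 16 ≤ lambdaMin (sampleMatrix x * (sampleMatrix x).transpose) := by
  have hsq : √L ^ 2 = L := Real.sq_sqrt hL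
  -- With `ε ≤ 1 / (16 ρ)` the loss `2 ε b` is at most `√L / 4`, half of `a`.
  have hbound := le_norm_apply_of_net (sampleCombination x) (a := √L / 2) (b := 2 * ρ * √L)
    (ε := min (1 / 2) (1 / (16 * ρ))) (by positivity) (min_le_left _ _) (by positivity) hN
    (fun v hv => by
      refine le_of_sq_le_sq ?_ (norm_nonneg _)
      rw [div_pow, hsq]
      linarith [hlow v hv])
    (fun v hv => by
      refine le_of_sq_le_sq ?_ (by positivity)
      rw [mul_pow, mul_pow, hsq]
      linarith [hup v hv])
  have hε : min (1 / 2) (1 / (16 * ρ)) * (16 * ρ) ≤ 1 := by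
    rw [← le_div_iff₀ (by positivity)]
    exact min_le_right _ _
  have hmin := le_lambdaMin_gram hm x (r := √L / 4) (by positivity) fun u hu => by
    refine le_trans ?_ (hbound u hu)
    nlinarith [Real.sqrt_nonneg L]
  rw [div_pow, hsq] at hmin
  linarith

end Main

theorem mainTheorem4 (ρ : ℝ) (hρ : 0 < ρ) (δ : ℝ) (hδ : δ ∈ Set.Ioo (0 : ℝ) 1) :
    ∃ β > (0 : ℝ), ∃ C > (0 : ℝ),
      ∀ (d : ℕ) (μ : Measure (EuclideanSpace ℝ (Fin d))) [IsProbabilityMeasure μ],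
        IsSubGaussianProduct ρ μ →
        (1 - covMatrix μ).PosSemidef →
        ∀ m : ℕ, (m : ℝ) ≤ β * (covMatrix μ).trace - C →
          δ ≤ (Measure.pi fun _ : Fin m => μ).real
            {x | (m : ℝ) ≤ lambdaMin (sampleMatrix x * (sampleMatrix x).transpose)} := by
  obtain ⟨hδ0, hδ1⟩ := hδ
  set ε : ℝ := min (1 / 2) (1 / (16 * ρ)) with hεdef
  have hε : 0 < ε := by positivity
  set c₀ : ℝ := min (1 / 2) (1 / (256 * ρ ^ 4)) with hc₀def
  have hc₀ : 0 < c₀ := by positivity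
  have hκ : 1 < 1 + 2 / ε := by
    have : 0 < 2 / ε := by positivity
    linarith
  have hlogκ : 0 < Real.log (1 + 2 / ε) := Real.log_pos hκ
  have hδ2 : 1 < 2 / (1 - δ) := by
    rw [lt_div_iff₀ (by linarith)]
    linarith
  -- The `1 / 16` yields `m ≤ L / 16`. The other term lets the net's entropy use at most half of the
  -- exponent `c₀ L`; `C` makes the remaining half beat `log (2 / (1 - δ))`.
  refine ⟨min (1 / 16) (c₀ / (2 * Real.log (1 + 2 / ε))), by positivity,
    2 / c₀ * Real.log (2 / (1 - δ)), mul_pos (by positivity) (Real.log_pos hδ2), ?_⟩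
  intro d μ _ ⟨a, hind, hsub⟩ hcov m hm
  rcases Nat.eq_zero_or_pos m with rfl | hmpos
  · have huniv : {x : Fin 0 → EuclideanSpace ℝ (Fin d) |
        ((0 : ℕ) : ℝ) ≤ lambdaMin (sampleMatrix x * (sampleMatrix x).transpose)} = Set.univ :=
      Set.eq_univ_of_forall fun x => by
        simpa using lambdaMin_nonneg_of_size_zero _
    rw [huniv, probReal_univ]
    exact hδ1.le
  set L := (covMatrix μ).trace with hLdef
  set β := min (1 / 16) (c₀ / (2 * Real.log (1 + 2 / ε))) with hβdef
  set C := 2 / c₀ * Real.log (2 / (1 - δ)) with hCdef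
  have hβpos : 0 < β := by positivity
  have hCpos : 0 < C := mul_pos (by positivity) (Real.log_pos hδ2)
  have hβ16 : β ≤ 1 / 16 := min_le_left _ _
  have hβκ : β * Real.log (1 + 2 / ε) ≤ c₀ / 2 := by
    have h : β ≤ c₀ / (2 * Real.log (1 + 2 / ε)) := min_le_right _ _
    rw [le_div_iff₀ (by positivity)] at h
    linarith
  have hm0 : (0 : ℝ) ≤ m := Nat.cast_nonneg m
  have hL : 0 < L := by
    have : 0 < β * L := by linarith
    exact (mul_pos_iff_of_pos_left hβpos).1 this
  have hmL : (m : ℝ) ≤ L / 16 := by nlinarith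
  -- Since `m ≥ 0`, the hypothesis on `m` forces `C ≤ β * L`.
  have hCL : C ≤ L := by nlinarith
  obtain ⟨N, hN1, hN, hNcard⟩ := exists_finset_net_sphere (E := EuclideanSpace ℝ (Fin m)) hε
  rw [finrank_euclideanSpace_fin] at hNcard
  set B : EuclideanSpace ℝ (Fin m) → Set (Fin m → EuclideanSpace ℝ (Fin d)) := fun v =>
    {x | 4 * ρ ^ 2 * L ≤ ‖sampleCombination x v‖ ^ 2} ∪ {x | ‖sampleCombination x v‖ ^ 2 ≤ L / 4}
    with hBdef
  have hBmeas : ∀ v, MeasurableSet (B v) := fun v => by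
    have hn : Measurable fun x : Fin m → EuclideanSpace ℝ (Fin d) =>
        ‖sampleCombination x v‖ ^ 2 := by
      simp_rw [sampleCombination_apply]
      fun_prop
    exact (measurableSet_le measurable_const hn).union (measurableSet_le hn measurable_const)
  set P := Measure.pi fun _ : Fin m => μ with hPdef
  have hbad : P.real (⋃ v ∈ N, B v) ≤ 1 - δ := by
    calc P.real (⋃ v ∈ N, B v) ≤ ∑ v ∈ N, P.real (B v) := measureReal_biUnion_finset_le _ _
      _ ≤ ∑ v ∈ N, 2 * Real.exp (-c₀ * L) := Finset.sum_le_sum fun v hv =>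
          measureReal_norm_sampleCombination_le hρ hind hsub hcov v (hN1 v hv)
      _ = N.card * (2 * Real.exp (-c₀ * L)) := by simp
      _ ≤ (1 + 2 / ε) ^ m * (2 * Real.exp (-c₀ * L)) := by gcongr
      _ = 2 * Real.exp (m * Real.log (1 + 2 / ε) - c₀ * L) := by
          rw [sub_eq_add_neg, Real.exp_add, Real.exp_nat_mul, Real.exp_log (by linarith), neg_mul]
          ring
      _ ≤ 2 * Real.exp (-Real.log (2 / (1 - δ))) := by
          gcongr
          have h1 : m * Real.log (1 + 2 / ε) ≤ β * L * Real.log (1 + 2 / ε) := by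
            gcongr
            linarith
          have h2 : β * L * Real.log (1 + 2 / ε) ≤ c₀ / 2 * L := by nlinarith
          have h3 : c₀ / 2 * C = Real.log (2 / (1 - δ)) := by
            rw [hCdef]
            field_simp
          have h4 : c₀ / 2 * C ≤ c₀ / 2 * L := by gcongr
          linarith
      _ = 1 - δ := by
          rw [Real.exp_neg, Real.exp_log (by linarith), inv_div]
          ring
  have hgood : δ ≤ P.real (⋃ v ∈ N, B v)ᶜ := by
    rw [probReal_compl_eq_one_sub (N.measurableSet_biUnion fun v _ => hBmeas v)]
    linarith
  refine hgood.trans (measureReal_mono fun x hx => ?_)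
  simp only [hBdef, Set.mem_compl_iff, Set.mem_iUnion, Set.mem_union, Set.mem_ofPred_eq,
    not_exists, not_or, not_le] at hx
  exact hmL.trans (trace_div_le_lambdaMin_of_net hmpos hρ hL.le hN x
    (fun v hv => (hx v hv).1.le) fun v hv => (hx v hv).2.le)
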